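/- Let $n\ge 2$ be an integer. Let $\mathbf A=(w_{ij})_{i,j=1}^n$ be a random real symmetric matrix from the Gaussian orthogonal ensemble GOE$(n)$, that is, $w_{ii}\sim N(0,2)$ for all $i$ and $w_{ij}\sim N(0,1)$ for all $i<j$. Let $\mathbf b=(b_1,\dots,b_n)$ be a random vector in $\mathbb R^n$ with $b_i\sim N(0,1)$ for all $i$. Assume that all the random variables $w_{ij}$ $(1\le i\le j\le n)$ and $b_1,\dots,b_n$ are (jointly) independent. For real $\epsilon\ge 0$ put $$P_\epsilon=\mathbb P\left(|\langle \mathbf v,\mathbf b\rangle|<\epsilon \text{ for some eigenvector } \mathbf v\in\mathbb R^n \text{ of } \mathbf A \text{ with } \|\mathbf v\|_2=1\right),$$ so that $P_0=0$. If the function $\epsilon\mapsto P_\epsilon$ on $[0,\infty)$ is (one-sidedly) differentiable at $0$, then its right derivative there satisfies $$\left.\frac{dP_\epsilon}{d\epsilon}\right|_{\epsilon=0^+}\le \frac{n(n-1)\,\Gamma\left(\frac{n-1}{2}\right)}{\sqrt2\,\Gamma\left(\frac n2\right)}.$$ -/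

import Mathlib

open MeasureTheory ProbabilityTheory

/-- The entries on and above the diagonal of a random matrix, as a family of real random variables
indexed by the pairs `(i, j)` with `i ≤ j`. -/
def upperEntries {Ω : Type*} {n : ℕ} (A : Ω → Matrix (Fin n) (Fin n) ℝ) :
    {p : Fin n × Fin n // p.1 ≤ p.2} → Ω → ℝ :=
  fun p ω => A ω p.1.1 p.1.2

/-- The random matrix `A` belongs to the Gaussian orthogonal ensemble GOE(n): it is symmetric, its
entries on and above the diagonal are independent, the diagonal entries have law `N(0,2)` and the
entries above the diagonal have law `N(0,1)`. -/
structure IsGOE {Ω : Type*} [MeasurableSpace Ω] {n : ℕ}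
    (A : Ω → Matrix (Fin n) (Fin n) ℝ) (μ : Measure Ω) : Prop where
  symm : ∀ᵐ ω ∂μ, (A ω).IsSymm
  indep : iIndepFun (upperEntries A) μ
  diag_law : ∀ i, HasLaw (fun ω => A ω i i) (gaussianReal 0 2) μ
  above_law : ∀ i j, i < j → HasLaw (fun ω => A ω i j) (gaussianReal 0 1) μ

/-- The coordinates of the random vector `b` are independent, each with law `N(0,1)`. -/
structure IsStdGaussianVector {Ω : Type*} [MeasurableSpace Ω] {n : ℕ}
    (b : Ω → EuclideanSpace ℝ (Fin n)) (μ : Measure Ω) : Prop where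
  indep : iIndepFun (fun i ω => b ω i) μ
  law : ∀ i, HasLaw (fun ω => b ω i) (gaussianReal 0 1) μ

/-- The `ε`-uncontrollability of the random system `dx/dt = A x + b u`: the probability that some
unit eigenvector `v` of `A` satisfies `|⟨v, b⟩| < ε`. -/
noncomputable def epsUncontrollability {Ω : Type*} [MeasurableSpace Ω] {n : ℕ}
    (μ : Measure Ω) (A : Ω → Matrix (Fin n) (Fin n) ℝ) (b : Ω → EuclideanSpace ℝ (Fin n))
    (ε : ℝ) : ℝ :=
  μ.real {ω | ∃ v : EuclideanSpace ℝ (Fin n),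
    (∃ c : ℝ, Module.End.HasEigenvector (Matrix.toEuclideanLin (A ω)) c v) ∧
      ‖v‖ = 1 ∧ |inner ℝ v (b ω)| < ε}

/-! The bound follows from a union bound. The discriminant is a nonzero polynomial in the entries,
so almost surely `A` has simple spectrum and only `n` unit eigenvectors up to sign. With `A` fixed,
each `⟨v, b⟩` is `N(0,1)`, with density at most `1/√(2π)`, so `P_ε ≤ n · 2ε/√(2π)`
(`IsGOE.epsUncontrollability_le`). Log-convexity of `Γ` shows that this slope is at most the stated
constant. -/

/-! ### Power sums and the discriminant. -/

section PowerSums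

variable {n : ℕ}

/-- The Hankel matrix `(tr A ^ (i + j))` of the power sums of the eigenvalues of `A`. Its
determinant is the discriminant of the characteristic polynomial of `A`. -/
def powerSumHankel {R : Type*} [CommRing R] (A : Matrix (Fin n) (Fin n) R) :
    Matrix (Fin n) (Fin n) R :=
  Matrix.of fun i j => (A ^ ((i : ℕ) + (j : ℕ))).trace

theorem powerSumHankel_diagonal {R : Type*} [CommRing R] (d : Fin n → R) :
    powerSumHankel (Matrix.diagonal d) =
      (Matrix.vandermonde d).transpose * Matrix.vandermonde d := by
  ext i j
  simp [powerSumHankel, Matrix.diagonal_pow, Matrix.mul_apply, Matrix.trace_diagonal, pow_add]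

theorem powerSumHankel_smul {R : Type*} [CommRing R] (c : R) (A : Matrix (Fin n) (Fin n) R) :
    powerSumHankel (c • A) =
      Matrix.diagonal (fun i : Fin n => c ^ (i : ℕ)) * powerSumHankel A *
        Matrix.diagonal (fun i : Fin n => c ^ (i : ℕ)) := by
  ext i j
  simp [powerSumHankel, Matrix.mul_diagonal, Matrix.diagonal_mul, smul_pow, pow_add]
  ring

theorem powerSumHankel_map {R S : Type*} [CommRing R] [CommRing S] (f : R →+* S)
    (A : Matrix (Fin n) (Fin n) R) :
    (powerSumHankel A).map f = powerSumHankel (A.map f) := by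
  ext i j
  simp only [powerSumHankel, Matrix.map_apply, Matrix.of_apply]
  rw [show A.map f = f.mapMatrix A from rfl, ← map_pow, RingHom.mapMatrix_apply,
    AddMonoidHom.map_trace]

theorem continuous_powerSumHankel :
    Continuous (powerSumHankel : Matrix (Fin n) (Fin n) ℝ → Matrix (Fin n) (Fin n) ℝ) := by
  refine continuous_matrix fun i j => ?_
  exact (continuous_pow ((i : ℕ) + (j : ℕ))).matrix_trace

theorem Matrix.IsHermitian.powerSumHankel_eq {A : Matrix (Fin n) (Fin n) ℝ}
    (hA : A.IsHermitian) :
    powerSumHankel A = powerSumHankel (Matrix.diagonal hA.eigenvalues) := by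
  ext i j
  simp only [powerSumHankel, Matrix.of_apply]
  conv_lhs => rw [hA.spectral_theorem, ← map_pow, Unitary.conjStarAlgAut_apply,
    Matrix.trace_mul_cycle, Unitary.coe_star_mul_self, one_mul]
  rfl

theorem Matrix.IsHermitian.eigenvalues_injective {A : Matrix (Fin n) (Fin n) ℝ}
    (hA : A.IsHermitian) (h : (powerSumHankel A).det ≠ 0) :
    Function.Injective hA.eigenvalues := by
  rw [hA.powerSumHankel_eq, powerSumHankel_diagonal, Matrix.det_mul, Matrix.det_transpose] at h
  exact Matrix.det_vandermonde_ne_zero_iff.1 (left_ne_zero_of_mul h)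

/-- With `t = 1/s` the pencil becomes `s A + D` up to scaling. Its discriminant is a polynomial in
`s` whose value at `0` is the squared Vandermonde determinant of `d`, hence nonzero. -/
theorem finite_det_powerSumHankel_add_smul_diagonal_eq_zero (A : Matrix (Fin n) (Fin n) ℝ)
    {d : Fin n → ℝ} (hd : Function.Injective d) :
    {t : ℝ | (powerSumHankel (A + t • Matrix.diagonal d)).det = 0}.Finite := by
  let q : Polynomial ℝ := (powerSumHankel ((Polynomial.X : Polynomial ℝ) • A.map Polynomial.C +
    (Matrix.diagonal d).map Polynomial.C)).det
  have heval (s : ℝ) : q.eval s = (powerSumHankel (s • A + Matrix.diagonal d)).det := by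
    have : q.eval s = Polynomial.evalRingHom s q := rfl
    rw [this, RingHom.map_det, RingHom.mapMatrix_apply, powerSumHankel_map]
    congr 2
    rw [Matrix.diagonal_map Polynomial.C_0]
    ext i j
    rcases eq_or_ne i j with rfl | h
    · simp only [Matrix.map_apply, Matrix.add_apply, Matrix.smul_apply, smul_eq_mul,
        Matrix.diagonal_apply_eq, Polynomial.coe_evalRingHom, Polynomial.eval_add,
        Polynomial.eval_mul, Polynomial.eval_X, Polynomial.eval_C]
    · simp only [Matrix.map_apply, Matrix.add_apply, Matrix.smul_apply, smul_eq_mul,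
        Matrix.diagonal_apply_ne _ h, Polynomial.coe_evalRingHom, Polynomial.eval_add,
        Polynomial.eval_mul, Polynomial.eval_X, Polynomial.eval_C, Polynomial.eval_zero]
  have hq : q ≠ 0 := by
    intro h0
    have := heval 0
    rw [h0, zero_smul, zero_add, powerSumHankel_diagonal, Matrix.det_mul,
      Matrix.det_transpose, Polynomial.eval_zero] at this
    exact mul_ne_zero (Matrix.det_vandermonde_ne_zero_iff.2 hd)
      (Matrix.det_vandermonde_ne_zero_iff.2 hd) this.symm
  refine (((q.rootSet_finite ℝ).image (·⁻¹)).insert 0).subset fun t ht => ?_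
  rcases eq_or_ne t 0 with rfl | ht0
  · simp
  refine Or.inr ⟨t⁻¹, ?_, inv_inv t⟩
  rw [Polynomial.mem_rootSet]
  refine ⟨hq, ?_⟩
  rw [Polynomial.coe_aeval_eq_eval, heval]
  have h : A + t • Matrix.diagonal d = t • (t⁻¹ • A + Matrix.diagonal d) := by
    rw [smul_add, smul_inv_smul₀ ht0]
  rw [Set.mem_ofPred_eq, h, powerSumHankel_smul, Matrix.det_mul, Matrix.det_mul,
    Matrix.det_diagonal] at ht
  have hp : ∏ i : Fin n, t ^ (i : ℕ) ≠ 0 :=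
    Finset.prod_ne_zero_iff.2 fun i _ => pow_ne_zero _ ht0
  simpa [hp] using ht

end PowerSums

/-! ### Simple spectrum for almost every symmetric matrix. -/

section SymmetricMatrices

variable {n : ℕ}

/-- The symmetric matrix with prescribed entries on and above the diagonal. -/
def symmMatrix (x : {p : Fin n × Fin n // p.1 ≤ p.2} → ℝ) : Matrix (Fin n) (Fin n) ℝ :=
  Matrix.of fun i j => x ⟨(min i j, max i j), min_le_max⟩

theorem isHermitian_symmMatrix (x : {p : Fin n × Fin n // p.1 ≤ p.2} → ℝ) :
    (symmMatrix x).IsHermitian := by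
  ext i j
  simp [symmMatrix, min_comm, max_comm]

theorem continuous_symmMatrix : Continuous (symmMatrix (n := n)) :=
  continuous_matrix fun _ _ => continuous_apply _

theorem symmMatrix_upperEntries {A : Matrix (Fin n) (Fin n) ℝ} (hA : A.IsSymm) :
    symmMatrix (fun p : {p : Fin n × Fin n // p.1 ≤ p.2} => A p.1.1 p.1.2) = A := by
  ext i j
  rcases le_total i j with h | h
  · simp [symmMatrix, h]
  · simpa [symmMatrix, h] using hA.apply i j

theorem symmMatrix_add_smul_diagonal (x : {p : Fin n × Fin n // p.1 ≤ p.2} → ℝ) (t : ℝ)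
    (d : Fin n → ℝ) :
    symmMatrix (x + t • fun p => if p.1.1 = p.1.2 then d p.1.1 else 0) =
      symmMatrix x + t • Matrix.diagonal d := by
  ext i j
  rcases lt_trichotomy i j with h | rfl | h
  · simp [symmMatrix, h.le, h.ne]
  · simp [symmMatrix]
  · simp [symmMatrix, h.le, h.ne']

/-- Every line in the direction `diag(0, …, n-1)` meets the zero set in finitely many points; Fubini
does the rest. -/
theorem ae_det_powerSumHankel_symmMatrix_ne_zero :
    ∀ᵐ x : {p : Fin n × Fin n // p.1 ≤ p.2} → ℝ, (powerSumHankel (symmMatrix x)).det ≠ 0 := by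
  let d : Fin n → ℝ := fun i => ((i : ℕ) : ℝ)
  have hd : Function.Injective d := fun i j h => Fin.ext (Nat.cast_injective h)
  let e : {p : Fin n × Fin n // p.1 ≤ p.2} → ℝ := fun p => if p.1.1 = p.1.2 then d p.1.1 else 0
  refine ae_mem_of_ae_add_linearMap_mem (LinearMap.toSpanSingleton ℝ _ e) volume volume
    (s := {x | (powerSumHankel (symmMatrix x)).det ≠ 0}) ?_ fun y => ?_
  · exact (isOpen_ne_fun (continuous_powerSumHankel.comp continuous_symmMatrix).matrix_det
      continuous_const).measurableSet
  · have hfin := finite_det_powerSumHankel_add_smul_diagonal_eq_zero (symmMatrix y) hd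
    filter_upwards [hfin.countable.ae_notMem volume] with t ht
    simpa [LinearMap.toSpanSingleton_apply, e, symmMatrix_add_smul_diagonal] using ht

end SymmetricMatrices

/-! ### Gaussian density bounds. -/

section GaussianMeasures

theorem gaussianReal_le_smul_volume (m : ℝ) {v : NNReal} (hv : v ≠ 0) :
    gaussianReal m v ≤ ENNReal.ofReal (√(2 * Real.pi * v))⁻¹ • volume := by
  refine Measure.le_iff.2 fun s _ => ?_
  rw [gaussianReal_apply _ hv, Measure.smul_apply, smul_eq_mul, ← setLIntegral_const]
  refine lintegral_mono fun x => ENNReal.ofReal_le_ofReal ?_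
  rw [gaussianPDFReal]
  refine mul_le_of_le_one_right (by positivity) (Real.exp_le_one_iff.2 ?_)
  rw [neg_div]
  exact neg_nonpos.2 (by positivity)

/-- Comparison on boxes suffices, because `OuterMeasure.pi` is the largest outer measure with the
given bounds on boxes. -/
theorem MeasureTheory.Measure.pi_le_smul_pi {ι : Type*} [Fintype ι] {α : ι → Type*}
    [∀ i, MeasurableSpace (α i)] {μ ν : ∀ i, Measure (α i)} [∀ i, SigmaFinite (μ i)]
    [∀ i, SigmaFinite (ν i)] {c : ι → NNReal} (h : ∀ i, μ i ≤ c i • ν i) :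
    Measure.pi μ ≤ (∏ i, c i) • Measure.pi ν := by
  have hpi : (∏ i, c i) • Measure.pi ν = Measure.pi fun i => c i • ν i := by
    refine (Measure.pi_eq fun s _ => ?_).symm
    simp only [Measure.smul_apply, Measure.pi_pi, ENNReal.smul_def, smul_eq_mul,
      Finset.prod_mul_distrib, ENNReal.ofNNReal_finsetProd]
  rw [hpi]
  have hle : (Measure.pi μ).toOuterMeasure ≤
      OuterMeasure.pi fun i => (c i • ν i).toOuterMeasure := by
    refine OuterMeasure.le_pi.2 fun s _ => ?_
    change Measure.pi μ _ ≤ _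
    rw [Measure.pi_pi]
    exact Finset.prod_le_prod' fun i _ => h i (s i)
  refine Measure.le_iff.2 fun s hs => ?_
  conv_rhs => rw [Measure.pi]
  exact (hle s).trans_eq (toMeasure_apply _ _ hs).symm

theorem pi_gaussianReal_absolutelyContinuous {ι : Type*} [Fintype ι] (m : ι → ℝ)
    {v : ι → NNReal} (hv : ∀ i, v i ≠ 0) :
    Measure.pi (fun i => gaussianReal (m i) (v i)) ≪ volume := by
  refine Measure.absolutelyContinuous_of_le_smul
    (c := ((∏ i, Real.toNNReal (√(2 * Real.pi * v i))⁻¹ : NNReal) : ENNReal)) ?_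
  exact Measure.pi_le_smul_pi fun i => gaussianReal_le_smul_volume (m i) (hv i)

theorem map_inner_pi_gaussianReal {n : ℕ} {v : EuclideanSpace ℝ (Fin n)} (hv : ‖v‖ = 1) :
    (Measure.pi fun _ : Fin n => gaussianReal 0 1).map (fun y => inner ℝ v (WithLp.toLp 2 y)) =
      gaussianReal 0 1 := by
  have hcomp : (fun y : Fin n → ℝ => inner ℝ v (WithLp.toLp 2 y)) =
      (innerSL ℝ v) ∘ WithLp.toLp 2 := rfl
  rw [hcomp, ← Measure.map_map (by fun_prop) (by fun_prop), map_pi_eq_stdGaussian,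
    IsGaussian.map_eq_gaussianReal, integral_strongDual_stdGaussian, variance_dual_stdGaussian,
    innerSL_apply_norm, hv]
  simp

theorem pi_gaussianReal_abs_inner_le {n : ℕ} {v : EuclideanSpace ℝ (Fin n)} (hv : ‖v‖ = 1)
    {ε : ℝ} :
    Measure.pi (fun _ : Fin n => gaussianReal 0 1) {y | |inner ℝ v (WithLp.toLp 2 y)| ≤ ε} ≤
      ENNReal.ofReal (√(2 * Real.pi))⁻¹ * ENNReal.ofReal (2 * ε) := by
  have h : {y : Fin n → ℝ | |inner ℝ v (WithLp.toLp 2 y)| ≤ ε} =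
      (fun y : Fin n → ℝ => inner ℝ v (WithLp.toLp 2 y)) ⁻¹' Metric.closedBall 0 ε := by
    ext y; simp
  rw [h, ← Measure.map_apply (by fun_prop) measurableSet_closedBall,
    map_inner_pi_gaussianReal hv]
  refine (gaussianReal_le_smul_volume 0 one_ne_zero _).trans ?_
  simp [Real.volume_closedBall]

end GaussianMeasures

/-! ### The Gamma function inequality. -/

theorem Real.Gamma_le_sqrt_pi_mul_Gamma_add_half {x : ℝ} (hx : 1 ≤ x) :
    Real.Gamma x ≤ √Real.pi * Real.Gamma (x + 1 / 2) := by
  have hs : 0 < x - 1 / 2 := by linarith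
  -- Log-convexity at the midpoint: `Γ(x)² ≤ Γ(x-1/2) Γ(x+1/2)`. By the recurrence, it remains that
  -- `1 ≤ π (x - 1/2)`.
  have h := Real.Gamma_mul_add_mul_le_rpow_Gamma_mul_rpow_Gamma hs
    (show 0 < x + 1 / 2 by linarith) one_half_pos one_half_pos (by norm_num)
  rw [show (1 : ℝ) / 2 * (x - 1 / 2) + 1 / 2 * (x + 1 / 2) = x by ring, ← Real.sqrt_eq_rpow,
    ← Real.sqrt_eq_rpow] at h
  have hrec : Real.Gamma (x + 1 / 2) = (x - 1 / 2) * Real.Gamma (x - 1 / 2) := by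
    rw [← Real.Gamma_add_one hs.ne']; congr 1; ring
  have hpos := Real.Gamma_pos_of_pos hs
  refine h.trans ?_
  rw [← Real.sqrt_mul hpos.le, hrec]
  refine Real.sqrt_le_iff.2 ⟨by positivity, ?_⟩
  rw [mul_pow, Real.sq_sqrt Real.pi_pos.le]
  have : 1 ≤ Real.pi * (x - 1 / 2) := by nlinarith [Real.pi_gt_three]
  have h2 : 0 ≤ Real.Gamma (x - 1 / 2) ^ 2 * (x - 1 / 2) := by positivity
  nlinarith

theorem mul_two_mul_inv_sqrt_le_Gamma_ratio {n : ℕ} (hn : 2 ≤ n) :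
    (n : ℝ) * ((√(2 * Real.pi))⁻¹ * 2) ≤
      (n : ℝ) * ((n : ℝ) - 1) * Real.Gamma (((n : ℝ) - 1) / 2) /
        (√2 * Real.Gamma ((n : ℝ) / 2)) := by
  have hn' : (2 : ℝ) ≤ n := by exact_mod_cast hn
  have hG : 0 < Real.Gamma ((n : ℝ) / 2) := Real.Gamma_pos_of_pos (by linarith)
  have hle := Real.Gamma_le_sqrt_pi_mul_Gamma_add_half (show 1 ≤ (n : ℝ) / 2 by linarith)
  have hrec : Real.Gamma ((n : ℝ) / 2 + 1 / 2) =
      ((n : ℝ) - 1) / 2 * Real.Gamma (((n : ℝ) - 1) / 2) := by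
    rw [← Real.Gamma_add_one (by linarith)]; congr 1; ring
  rw [hrec] at hle
  rw [le_div_iff₀ (by positivity), Real.sqrt_mul zero_le_two]
  have hpi : 0 < √Real.pi := Real.sqrt_pos.2 Real.pi_pos
  have h2 : 0 < √(2 : ℝ) := by positivity
  calc (n : ℝ) * ((√2 * √Real.pi)⁻¹ * 2) * (√2 * Real.Gamma ((n : ℝ) / 2))
      = n * (2 / √Real.pi) * Real.Gamma ((n : ℝ) / 2) := by field_simp
    _ ≤ n * (2 / √Real.pi) *
          (√Real.pi * (((n : ℝ) - 1) / 2 * Real.Gamma (((n : ℝ) - 1) / 2))) := by gcongr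
    _ = _ := by field_simp

/-! ### The event for a fixed matrix. -/

/-- The pairs `(x, y)` such that the symmetric matrix with upper entries `x` has a unit eigenvector
whose inner product with `y` is at most `ε` in absolute value. -/
def almostUncontrollable (n : ℕ) (ε : ℝ) :
    Set (({p : Fin n × Fin n // p.1 ≤ p.2} → ℝ) × (Fin n → ℝ)) :=
  {z | ∃ v : EuclideanSpace ℝ (Fin n), ‖v‖ = 1 ∧
    (∃ c : ℝ, Matrix.toEuclideanLin (symmMatrix z.1) v = c • v) ∧
      |inner ℝ v (WithLp.toLp 2 z.2)| ≤ ε}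

/-- Projection along the compact unit sphere is a closed map. The eigenvalue, which ranges over a
noncompact set, is eliminated as the Rayleigh quotient `⟨v, Av⟩`. -/
theorem isClosed_almostUncontrollable (n : ℕ) (ε : ℝ) :
    IsClosed (almostUncontrollable n ε) := by
  let F : (({p : Fin n × Fin n // p.1 ≤ p.2} → ℝ) × (Fin n → ℝ)) ×
      Metric.sphere (0 : EuclideanSpace ℝ (Fin n)) 1 → EuclideanSpace ℝ (Fin n) :=
    fun z => WithLp.toLp 2 ((symmMatrix z.1.1).mulVec (WithLp.ofLp z.2.1))
  have hF : Continuous F := by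
    refine (PiLp.continuous_toLp 2 _).comp ?_
    refine Continuous.matrix_mulVec (continuous_symmMatrix.comp (by fun_prop)) ?_
    exact (PiLp.continuous_ofLp 2 _).comp (by fun_prop)
  have hclosed : IsClosed {z | F z = (inner ℝ z.2.1 (F z) : ℝ) • z.2.1 ∧
      |inner ℝ z.2.1 (WithLp.toLp 2 z.1.2)| ≤ ε} := by
    have hbc : Continuous fun z : (({p : Fin n × Fin n // p.1 ≤ p.2} → ℝ) × (Fin n → ℝ)) ×
        Metric.sphere (0 : EuclideanSpace ℝ (Fin n)) 1 => WithLp.toLp 2 z.1.2 :=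
      (PiLp.continuous_toLp 2 _).comp (by fun_prop)
    rw [Set.ofPred_and]
    exact (isClosed_eq hF (by fun_prop)).inter (isClosed_le (by fun_prop) continuous_const)
  convert isClosedMap_fst_of_compactSpace _ hclosed using 1
  ext z
  simp only [almostUncontrollable, Set.mem_ofPred_eq, Set.mem_image, Prod.exists,
    exists_and_right, exists_eq_right]
  constructor
  · rintro ⟨v, hv, ⟨c, hc⟩, hz⟩
    refine ⟨⟨v, by simpa using hv⟩, ?_, hz⟩
    have hFz : F (z, ⟨v, by simpa using hv⟩) = c • v := hc
    have hin : inner ℝ v (c • v) = c := by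
      rw [inner_smul_right, real_inner_self_eq_norm_sq, hv, one_pow, mul_one]
    rw [hFz, hin]
  · rintro ⟨v, hv, hz⟩
    exact ⟨v, by simp, ⟨_, hv⟩, hz⟩

/-- Symmetry gives `(λᵢ - c)⟨eᵢ, v⟩ = 0`, so distinct eigenvalues leave exactly one nonzero
coordinate. -/
theorem Matrix.IsHermitian.exists_eq_smul_eigenvectorBasis {n : ℕ} {A : Matrix (Fin n) (Fin n) ℝ}
    (hA : A.IsHermitian) (hinj : Function.Injective hA.eigenvalues)
    {v : EuclideanSpace ℝ (Fin n)} (hv : v ≠ 0) {c : ℝ}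
    (h : Matrix.toEuclideanLin A v = c • v) :
    ∃ i, v = inner ℝ (hA.eigenvectorBasis i) v • hA.eigenvectorBasis i := by
  have hsymm := Matrix.isSymmetric_toEuclideanLin_iff.2 hA
  have happ (i : Fin n) : Matrix.toEuclideanLin A (hA.eigenvectorBasis i) =
      hA.eigenvalues i • hA.eigenvectorBasis i := by
    rw [Matrix.toLpLin_apply, hA.mulVec_eigenvectorBasis]
    rfl
  have hcoef (i : Fin n) (hi : inner ℝ (hA.eigenvectorBasis i) v ≠ 0) :
      hA.eigenvalues i = c := by
    have := hsymm (hA.eigenvectorBasis i) v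
    rw [happ, h, inner_smul_left, inner_smul_right] at this
    exact mul_right_cancel₀ hi this
  obtain ⟨i, hi⟩ : ∃ i, inner ℝ (hA.eigenvectorBasis i) v ≠ 0 := by
    by_contra! h0
    apply hv
    rw [← hA.eigenvectorBasis.sum_repr' v]
    simp [h0]
  refine ⟨i, ?_⟩
  conv_lhs => rw [← hA.eigenvectorBasis.sum_repr' v]
  refine Finset.sum_eq_single_of_mem i (Finset.mem_univ i) fun j _ hj => ?_
  have : inner ℝ (hA.eigenvectorBasis j) v = 0 := by
    by_contra hj0
    exact hj (hinj ((hcoef j hj0).trans (hcoef i hi).symm))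
  rw [this, zero_smul]

theorem pi_gaussianReal_almostUncontrollable_section_le {n : ℕ} (ε : ℝ)
    {x : {p : Fin n × Fin n // p.1 ≤ p.2} → ℝ} (hx : (powerSumHankel (symmMatrix x)).det ≠ 0) :
    Measure.pi (fun _ : Fin n => gaussianReal 0 1) (Prod.mk x ⁻¹' almostUncontrollable n ε) ≤
      n * (ENNReal.ofReal (√(2 * Real.pi))⁻¹ * ENNReal.ofReal (2 * ε)) := by
  have hA := isHermitian_symmMatrix x
  have hsub : Prod.mk x ⁻¹' almostUncontrollable n ε ⊆
      ⋃ i, {y | |inner ℝ (hA.eigenvectorBasis i) (WithLp.toLp 2 y)| ≤ ε} := by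
    rintro y ⟨v, hv, ⟨c, hc⟩, hy⟩
    have hv0 : v ≠ 0 := by rintro rfl; simp at hv
    obtain ⟨i, hi⟩ := hA.exists_eq_smul_eigenvectorBasis (hA.eigenvalues_injective hx) hv0 hc
    refine Set.mem_iUnion.2 ⟨i, ?_⟩
    set a : ℝ := inner ℝ (hA.eigenvectorBasis i) v
    have ha : |a| = 1 := by
      rw [hi, norm_smul, hA.eigenvectorBasis.norm_eq_one, mul_one] at hv
      exact hv
    rw [hi, real_inner_smul_left, abs_mul, ha, one_mul] at hy
    exact hy
  refine (measure_mono hsub).trans ((measure_iUnion_fintype_le _ _).trans ?_)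
  refine (Finset.sum_le_sum fun i _ =>
    pi_gaussianReal_abs_inner_le (hA.eigenvectorBasis.norm_eq_one i)).trans_eq ?_
  simp

/-! ### Joint law and integration over the matrix. -/

section Law

variable {Ω : Type*} [MeasurableSpace Ω] {μ : Measure Ω} {n : ℕ}
  {A : Ω → Matrix (Fin n) (Fin n) ℝ} {b : Ω → EuclideanSpace ℝ (Fin n)}

theorem IsGOE.hasLaw_upperEntries (hA : IsGOE A μ) (p : {p : Fin n × Fin n // p.1 ≤ p.2}) :
    HasLaw (upperEntries A p) (gaussianReal 0 (if p.1.1 = p.1.2 then 2 else 1)) μ := by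
  obtain ⟨⟨i, j⟩, hij⟩ := p
  rcases eq_or_lt_of_le hij with h | h
  · obtain rfl : i = j := h
    simpa using! hA.diag_law i
  · have hne : i ≠ j := h.ne
    simpa [hne] using! hA.above_law i j h

theorem IsGOE.hasLaw_prodMk [IsProbabilityMeasure μ] (hA : IsGOE A μ)
    (hb : IsStdGaussianVector b μ)
    (hAb : iIndepFun (Sum.elim (upperEntries A) (fun i ω => b ω i)) μ) :
    HasLaw (fun ω => (fun p => upperEntries A p ω, fun i => b ω i))
      ((Measure.pi fun p : {p : Fin n × Fin n // p.1 ≤ p.2} =>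
        gaussianReal 0 (if p.1.1 = p.1.2 then 2 else 1)).prod
          (Measure.pi fun _ : Fin n => gaussianReal 0 1)) μ := by
  let γ : {p : Fin n × Fin n // p.1 ≤ p.2} ⊕ Fin n → Measure ℝ :=
    Sum.elim (fun p => gaussianReal 0 (if p.1.1 = p.1.2 then 2 else 1)) fun _ => gaussianReal 0 1
  have hlaw (k) : HasLaw (Sum.elim (upperEntries A) (fun i ω => b ω i) k) (γ k) μ := by
    rcases k with p | i
    · exact hA.hasLaw_upperEntries p
    · exact hb.law i
  have (k : {p : Fin n × Fin n // p.1 ≤ p.2} ⊕ Fin n) : IsProbabilityMeasure (γ k) := by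
    cases k
    · exact instIsProbabilityMeasureGaussianReal ..
    · exact instIsProbabilityMeasureGaussianReal ..
  have hjoint : HasLaw (fun ω k => Sum.elim (upperEntries A) (fun i ω => b ω i) k ω)
      (Measure.pi γ) μ := by
    refine ⟨aemeasurable_pi_lambda _ fun k => (hlaw k).aemeasurable, ?_⟩
    rw [(iIndepFun_iff_map_fun_eq_pi_map fun k => (hlaw k).aemeasurable).1 hAb]
    simp_rw [(hlaw _).map_eq]
  have hsplit := measurePreserving_sumPiEquivProdPi γ
  exact HasLaw.comp ⟨hsplit.measurable.aemeasurable, hsplit.map_eq⟩ hjoint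

theorem IsGOE.epsUncontrollability_le [IsProbabilityMeasure μ] (hA : IsGOE A μ)
    (hb : IsStdGaussianVector b μ)
    (hAb : iIndepFun (Sum.elim (upperEntries A) (fun i ω => b ω i)) μ) {ε : ℝ} (hε : 0 ≤ ε) :
    epsUncontrollability μ A b ε ≤ n * ((√(2 * Real.pi))⁻¹ * 2) * ε := by
  have hlaw := hA.hasLaw_prodMk hb hAb
  have hS : MeasurableSet (almostUncontrollable n ε) :=
    (isClosed_almostUncontrollable n ε).measurableSet
  have hprod : ((Measure.pi fun p : {p : Fin n × Fin n // p.1 ≤ p.2} =>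
        gaussianReal 0 (if p.1.1 = p.1.2 then 2 else 1)).prod
          (Measure.pi fun _ : Fin n => gaussianReal 0 1)) (almostUncontrollable n ε) ≤
      n * (ENNReal.ofReal (√(2 * Real.pi))⁻¹ * ENNReal.ofReal (2 * ε)) := by
    have hac := pi_gaussianReal_absolutelyContinuous
      (fun _ : {p : Fin n × Fin n // p.1 ≤ p.2} => (0 : ℝ))
      (v := fun p => if p.1.1 = p.1.2 then 2 else 1) (fun p => by split_ifs <;> simp)
    rw [Measure.prod_apply hS]
    refine (lintegral_mono_ae (g := fun _ =>
      n * (ENNReal.ofReal (√(2 * Real.pi))⁻¹ * ENNReal.ofReal (2 * ε))) ?_).trans_eq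
        (by rw [lintegral_const, measure_univ, mul_one])
    filter_upwards [hac.ae_le ae_det_powerSumHankel_symmMatrix_ne_zero] with x hx
    exact pi_gaussianReal_almostUncontrollable_section_le ε hx
  rw [epsUncontrollability, measureReal_def]
  refine ENNReal.toReal_le_of_le_ofReal (by positivity) ?_
  calc μ _ ≤ μ ((fun ω => (fun p => upperEntries A p ω, fun i => b ω i)) ⁻¹'
        almostUncontrollable n ε) := by
        -- Almost-everywhere inclusion in a closed set suffices; measurability of the event itself
        -- is not needed.
        refine measure_mono_ae ?_
        filter_upwards [hA.symm] with ω hω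
        rintro ⟨v, ⟨c, hc⟩, hv, hlt⟩
        refine ⟨v, hv, ⟨c, ?_⟩, hlt.le⟩
        have := symmMatrix_upperEntries hω
        exact (congrArg (fun M => Matrix.toEuclideanLin M v) this).trans hc.apply_eq_smul
    _ = _ := by rw [← Measure.map_apply_of_aemeasurable hlaw.aemeasurable hS, hlaw.map_eq]
    _ ≤ _ := hprod
    _ = _ := by
        rw [← ENNReal.ofReal_natCast, ← ENNReal.ofReal_mul (by positivity),
          ← ENNReal.ofReal_mul (by positivity)]
        congr 1
        ring

end Law

/-! ### From the linear bound to the derivative. -/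

theorem derivWithin_Ici_zero_le_of_le_mul {f : ℝ → ℝ} {C : ℝ}
    (hf : DifferentiableWithinAt ℝ f (Set.Ici 0) 0) (h0 : 0 ≤ f 0)
    (hle : ∀ x, 0 ≤ x → f x ≤ C * x) : derivWithin f (Set.Ici 0) 0 ≤ C := by
  have hd := hf.hasDerivWithinAt.Ioi_of_Ici
  rw [hasDerivWithinAt_iff_tendsto_slope' Set.self_notMem_Ioi] at hd
  refine le_of_tendsto hd ?_
  filter_upwards [self_mem_nhdsWithin] with x hx
  rw [slope_def_field, sub_zero, div_le_iff₀ hx]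
  linarith [hle x (le_of_lt hx)]

theorem corollary5p7 {Ω : Type*} [MeasurableSpace Ω] (μ : Measure Ω) [IsProbabilityMeasure μ]
    (n : ℕ) (hn : 2 ≤ n)
    (A : Ω → Matrix (Fin n) (Fin n) ℝ) (b : Ω → EuclideanSpace ℝ (Fin n))
    (hA : IsGOE A μ) (hb : IsStdGaussianVector b μ)
    (hAb : iIndepFun (Sum.elim (upperEntries A) (fun i ω => b ω i)) μ)
    (hP : DifferentiableWithinAt ℝ (epsUncontrollability μ A b) (Set.Ici 0) 0) :
    derivWithin (epsUncontrollability μ A b) (Set.Ici 0) 0 ≤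
      (n : ℝ) * ((n : ℝ) - 1) * Real.Gamma (((n : ℝ) - 1) / 2) /
        (√2 * Real.Gamma ((n : ℝ) / 2)) :=
  (derivWithin_Ici_zero_le_of_le_mul hP measureReal_nonneg fun _ hε =>
    hA.epsUncontrollability_le hb hAb hε).trans (mul_two_mul_inv_sqrt_le_Gamma_ratio hn)
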